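/- Let $\mathcal I=\{(\theta,\alpha,\beta)\in(0,\frac\pi2)\times[0,\frac\pi2]^2 : (\alpha,\beta)\neq(0,\theta)\}$. For $\theta\in(0,\frac\pi2)$ put $\lambda=\cot\frac\theta2$ and let $\Sigma_\theta$ be the compact Riemann surface of genus one of the curve $w^2=(z^2+\lambda^2)(z^2+\lambda^{-2})$ (with two points over $z=\infty$). For $(\theta,\alpha,\beta)\in\mathcal I$ let $$g=\frac{z\left(i\cos\frac{\alpha-\beta}2+\cos\frac{\alpha+\beta}2\right)+\sin\frac{\alpha-\beta}2+i\sin\frac{\alpha+\beta}2}{\cos\frac{\alpha-\beta}2+i\cos\frac{\alpha+\beta}2-z\left(i\sin\frac{\alpha-\beta}2+\sin\frac{\alpha+\beta}2\right)},\qquad dh=\mu(\theta)\,\frac{dz}{w},\qquad \mu(\theta)=\frac{\pi}{\sin\theta\,K(\sin^2\theta)},$$ where $K(m)=\int_0^{\pi/2}\frac{du}{\sqrt{1-m\sin^2u}}$, and let $\Phi=\left(\frac12(g^{-1}-g),\frac i2(g^{-1}+g),1\right)dh$ on $\Sigma_\theta\setminus g^{-1}(\{0,\infty\})$. The standard example $M_{\theta,\alpha,\beta}$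 is the minimal surface with Weierstrass form $\Phi$: its lift to $\mathbb R^3$ is the set of all values $\mathrm{Re}\int_\gamma\Phi$, where $\gamma$ runs over the curves in $\Sigma_\theta\setminus g^{-1}(\{0,\infty\})$ that start at the branch point $(z,w)=(i\lambda,0)$ (this fixes the surface among its translates), and its period group is generated by the vectors $\mathrm{Re}\int_\gamma\Phi$ for closed curves $\gamma$ in $\Sigma_\theta\setminus g^{-1}(\{0,\infty\})$. The conjugate surface $M^*_{\theta,\alpha,\beta}$ is obtained in the same way from $i\Phi$ in place of $\Phi$. For every $(\theta,\alpha,\beta)\in\mathcal I$, the triple $(\frac\pi2-\theta,\alpha,\frac\pi2-\beta)$ also lies in $\mathcal I$, and $M_{\frac\pi2-\theta,\alpha,\frac\pi2-\beta}$ is the image of $M^*_{\theta,\alpha,\beta}$ under the homothety of ratio $r=\frac{\mu(\frac\pi2-\theta)}{\mu(\theta)\tan\theta}>0$ followed by the reflection in a plane orthogonal to the $x_2$-axis; that is, this map sends the lift of the one surface onto the lift of the other, and its linear part sends the one period group onto the other. Hence the family of standard examples is self-conjugate: for every $(\theta,\alpha,\beta)\in\mathcal I$ there is $(\theta',\alpha',\beta')\in\mathcal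 I$, and conversely for every $(\theta',\alpha',\beta')\in\mathcal I$ there is $(\theta,\alpha,\beta)\in\mathcal I$, such that $M_{\theta',\alpha',\beta'}$ is the image of $M^*_{\theta,\alpha,\beta}$ under a homothety of positive ratio followed by a reflection in a plane orthogonal to the $x_2$-axis. -/

import Mathlib

open Set

noncomputable section

namespace StandardExamples

/-- The parameter range `I`: triples `(θ, α, β)` in `(0, π/2) × [0, π/2]²` with `(α, β) ≠ (0, θ)`. -/
def paramRange : Set (ℝ × ℝ × ℝ) :=
  {p | p.1 ∈ Ioo 0 (Real.pi / 2) ∧ p.2.1 ∈ Icc 0 (Real.pi / 2) ∧ p.2.2 ∈ Icc 0 (Real.pi / 2) ∧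
    (p.2.1, p.2.2) ≠ (0, p.1)}

/-- `λ(θ) = cot (θ / 2)`. -/
def lam (θ : ℝ) : ℝ := Real.cot (θ / 2)

/-- The polynomial `(z² + λ²)(z² + λ⁻²)`, homogenized by `z = y / x`. -/
def quartic (θ : ℝ) (x y : ℂ) : ℂ :=
  (y ^ 2 + (lam θ : ℂ) ^ 2 * x ^ 2) * (y ^ 2 + ((lam θ : ℂ) ^ 2)⁻¹ * x ^ 2)

/-- A `C¹` curve, parametrized by `[0, 1]`, in the compact Riemann surface
`Σ_θ : w² = (z² + λ²)(z² + λ⁻²)`.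
The surface is described by homogeneous coordinates `(x, y, w)` with `(x, y) ≠ (0, 0)` and
`w² = quartic θ x y`, where `(x, y, w)` and `(c x, c y, c² w)` are the same point for `c ≠ 0`.
The affine coordinates of the point are `(y / x, w / x²)`; the two points over `z = ∞` are those
with `x = 0`.

`vel t` is the value of the holomorphic differential `dz / w` on the velocity of the curve at time
`t`. It is determined by the three equations `vel_x`, `vel_y`, `vel_z`, as `w` and the two partial
derivatives of the quartic never vanish simultaneously. For `x = 1` these equations include
`z' = vel * w` and `w' = vel * p'(z) / 2`, where `p(z) = (z² + λ²)(z² + λ⁻²)`; the second one gives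
the value of `dz / w` where `w = 0`. -/
structure Curve (θ : ℝ) where
  x : ℝ → ℂ
  y : ℝ → ℂ
  w : ℝ → ℂ
  vel : ℝ → ℂ
  contDiff_x : ContDiff ℝ 1 x
  contDiff_y : ContDiff ℝ 1 y
  contDiff_w : ContDiff ℝ 1 w
  ne_zero : ∀ t ∈ Icc (0 : ℝ) 1, (x t, y t) ≠ (0, 0)
  equation : ∀ t ∈ Icc (0 : ℝ) 1, w t ^ 2 = quartic θ (x t) (y t)
  vel_z : ∀ t ∈ Icc (0 : ℝ) 1, x t * deriv y t - y t * deriv x t = vel t * w t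
  vel_x : ∀ t ∈ Icc (0 : ℝ) 1, x t * deriv w t - 2 * w t * deriv x t =
    vel t * (deriv (fun s : ℂ => quartic θ (x t) s) (y t) / 2)
  vel_y : ∀ t ∈ Icc (0 : ℝ) 1, y t * deriv w t - 2 * w t * deriv y t =
    -(vel t * (deriv (fun s : ℂ => quartic θ s (y t)) (x t) / 2))

/-- The curve is closed in `Σ_θ`. -/
def Curve.IsClosed {θ : ℝ} (γ : Curve θ) : Prop :=
  ∃ c : ℂ, c ≠ 0 ∧ γ.x 1 = c * γ.x 0 ∧ γ.y 1 = c * γ.y 0 ∧ γ.w 1 = c ^ 2 * γ.w 0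

/-- The curve starts at the branch point `(z, w) = (i λ, 0)` of the `z`-projection. -/
def Curve.StartsAtBase {θ : ℝ} (γ : Curve θ) : Prop :=
  γ.y 0 = Complex.I * (lam θ : ℂ) * γ.x 0

/-- Numerator of the Gauss map, homogenized by `z = y / x`. -/
def gaussNum (α β : ℝ) (x y : ℂ) : ℂ :=
  y * (Complex.I * (Real.cos ((α - β) / 2) : ℂ) + (Real.cos ((α + β) / 2) : ℂ)) +
    x * ((Real.sin ((α - β) / 2) : ℂ) + Complex.I * (Real.sin ((α + β) / 2) : ℂ))

/-- Denominator of the Gauss map, homogenized by `z = y / x`. -/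
def gaussDen (α β : ℝ) (x y : ℂ) : ℂ :=
  x * ((Real.cos ((α - β) / 2) : ℂ) + Complex.I * (Real.cos ((α + β) / 2) : ℂ)) -
    y * (Complex.I * (Real.sin ((α - β) / 2) : ℂ) + (Real.sin ((α + β) / 2) : ℂ))

/-- The stereographically projected Gauss map `g` of `M_{θ,α,β}`, away from its poles. -/
def gauss (α β : ℝ) (x y : ℂ) : ℂ := gaussNum α β x y / gaussDen α β x y

/-- The curve avoids the four ends, which are the points of `Σ_θ` where `g = 0` or `g = ∞`. -/
def Curve.AvoidsEnds {θ : ℝ} (γ : Curve θ) (α β : ℝ) : Prop :=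
  ∀ t ∈ Icc (0 : ℝ) 1, gaussNum α β (γ.x t) (γ.y t) ≠ 0 ∧ gaussDen α β (γ.x t) (γ.y t) ≠ 0

/-- The complete elliptic integral of the first kind, as a function of the parameter `m = k²`. -/
def ellipticK (m : ℝ) : ℝ :=
  ∫ u in (0 : ℝ)..(Real.pi / 2), 1 / Real.sqrt (1 - m * Real.sin u ^ 2)

/-- The real factor `μ(θ)` in the height differential `dh = μ dz / w`. -/
def mu (θ : ℝ) : ℝ := Real.pi / (Real.sin θ * ellipticK (Real.sin θ ^ 2))

/-- The coefficients of `dh` in the Weierstrass form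
`Φ = ((g⁻¹ - g) / 2, i (g⁻¹ + g) / 2, 1) dh`. -/
def weierstrassCoeff (g : ℂ) : Fin 3 → ℂ :=
  ![(g⁻¹ - g) / 2, Complex.I / 2 * (g⁻¹ + g), 1]

/-- The vector `Re (κ ∫_γ Φ)`, where `Φ` is the Weierstrass form of `M_{θ,α,β}`. -/
def displacement {θ : ℝ} (κ : ℂ) (α β : ℝ) (γ : Curve θ) : EuclideanSpace ℝ (Fin 3) :=
  WithLp.toLp 2 fun j => (κ * ∫ t in (0 : ℝ)..1,
    weierstrassCoeff (gauss α β (γ.x t) (γ.y t)) j * ((mu θ : ℂ) * γ.vel t)).re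

/-- A doubly periodic surface `M = M̃ / P`, given by the lift `M̃ ⊆ ℝ³` and the period group `P`. -/
structure PeriodicSurface where
  lift : Set (EuclideanSpace ℝ (Fin 3))
  periods : AddSubgroup (EuclideanSpace ℝ (Fin 3))

/-- The surface with Weierstrass form `κ Φ`, where `Φ` is the Weierstrass form of `M_{θ,α,β}`: its
lift is the image of the multivalued map `p ↦ Re ∫^p κ Φ` on `Σ_θ` minus the ends, placed so that
the branch point `(i λ, 0)` is mapped to the origin, and its period group is generated by the vectors
`Re ∫_γ κ Φ` for closed curves `γ` in `Σ_θ` minus the ends. -/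
def associateSurface (κ : ℂ) (θ α β : ℝ) : PeriodicSurface where
  lift := {X | ∃ γ : Curve θ, γ.AvoidsEnds α β ∧ γ.StartsAtBase ∧ X = displacement κ α β γ}
  periods := AddSubgroup.closure
    {X | ∃ γ : Curve θ, γ.AvoidsEnds α β ∧ γ.IsClosed ∧ X = displacement κ α β γ}

/-- The standard example `M_{θ,α,β}`. -/
def standardExample (θ α β : ℝ) : PeriodicSurface := associateSurface 1 θ α β

/-- The conjugate surface `M*_{θ,α,β}`, with Weierstrass form `i Φ`: its coordinate functions are
harmonic conjugates, up to sign, of those of `M_{θ,α,β}`. -/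
def conjugateExample (θ α β : ℝ) : PeriodicSurface := associateSurface Complex.I θ α β

/-- The reflection of `ℝ³` in the plane `x₂ = b` (coordinates are numbered `0, 1, 2` here). -/
def reflectX2 (b : ℝ) (X : EuclideanSpace ℝ (Fin 3)) : EuclideanSpace ℝ (Fin 3) :=
  !₂[X 0, 2 * b - X 1, X 2]

/-- `N` is the image of `M` under the homothety of ratio `r` followed by the reflection in some plane
orthogonal to the `x₂`-axis. Period vectors transform by the linear part of this map. -/
def CoincideUpToReflection (r : ℝ) (M N : PeriodicSurface) : Prop :=
  ∃ b : ℝ, N.lift = (fun X => reflectX2 b (r • X)) '' M.lift ∧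
    (N.periods : Set (EuclideanSpace ℝ (Fin 3))) =
      (fun X => reflectX2 0 (r • X)) '' (M.periods : Set (EuclideanSpace ℝ (Fin 3)))

end StandardExamples

end

open StandardExamples

open scoped ComplexConjugate

namespace StandardExamples

/-! The map `z ↦ (z̄ - i) / (1 - i z̄)` lifts to an antiholomorphic isomorphism from `Σ_θ` to
`Σ_{π/2-θ}`. Indeed the quartic is `(x² + y²)² + (2xy / tan θ)²`, and the substitution sends `x² +
y²` to `-4i x̄ȳ` and `xy` to `-i(x̄² + ȳ²)`, so the two squares trade places and `tan θ` is
inverted.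

Base point goes to base point, the Gauss map for `(α, π/2 - β)` pulls back to `conj g`
(`gauss_compl`), and `dz/w` pulls back to `conj (i dz/w) / tan θ` (`Curve.conjDual`). Hence the new
Weierstrass form pulls back to `r · diag(1, -1, 1) · conj (i Φ)`, and real parts give
`displacement_conjDual`. Applying the construction from `π/2 - θ` back to `θ` gives the reverse
inclusions. -/

/-! ### The quartic in terms of `tan θ` -/

/-- Square `cot (θ/2) - tan (θ/2) = 2 cot θ`. -/
theorem lam_sq_add_inv {θ : ℝ} (hθ : θ ∈ Ioo 0 (Real.pi / 2)) :
    lam θ ^ 2 + (lam θ ^ 2)⁻¹ = 2 + 4 / Real.tan θ ^ 2 := by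
  have h1 : 0 < Real.sin (θ / 2) := Real.sin_pos_of_pos_of_lt_pi (by linarith [hθ.1])
    (by linarith [hθ.2, Real.pi_pos])
  have h2 : 0 < Real.cos (θ / 2) := Real.cos_pos_of_mem_Ioo
    ⟨by linarith [hθ.1, Real.pi_pos], by linarith [hθ.2, Real.pi_pos]⟩
  have h3 : Real.sin θ = 2 * Real.sin (θ / 2) * Real.cos (θ / 2) := by
    rw [← Real.sin_two_mul]; congr 1; ring
  have h4 : Real.cos θ = Real.cos (θ / 2) ^ 2 - Real.sin (θ / 2) ^ 2 := by
    rw [← Real.cos_two_mul']; congr 1; ring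
  rw [lam, Real.cot_eq_cos_div_sin, Real.tan_eq_sin_div_cos, div_pow (Real.sin θ),
    div_div_eq_mul_div, h3, h4]
  field_simp
  ring

theorem tan_pos_of_mem {θ : ℝ} (hθ : θ ∈ Ioo 0 (Real.pi / 2)) : 0 < Real.tan θ :=
  Real.tan_pos_of_pos_of_lt_pi_div_two hθ.1 hθ.2

theorem pi_div_two_sub_mem {θ : ℝ} (hθ : θ ∈ Ioo 0 (Real.pi / 2)) :
    Real.pi / 2 - θ ∈ Ioo 0 (Real.pi / 2) :=
  ⟨by linarith [hθ.2], by linarith [hθ.1]⟩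

/-- The quartic in expanded form, with its coefficient in terms of `tan θ`. -/
theorem quartic_eq {θ : ℝ} (hθ : θ ∈ Ioo 0 (Real.pi / 2)) (x y : ℂ) :
    quartic θ x y = y ^ 4 + (2 + 4 / (Real.tan θ : ℂ) ^ 2) * x ^ 2 * y ^ 2 + x ^ 4 := by
  have h : ((lam θ : ℂ)) ^ 2 + ((lam θ : ℂ) ^ 2)⁻¹ = 2 + 4 / (Real.tan θ : ℂ) ^ 2 := by
    exact_mod_cast congrArg (fun r : ℝ => (r : ℂ)) (lam_sq_add_inv hθ)
  have h0 : (lam θ : ℂ) ^ 2 ≠ 0 := by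
    intro h0
    have h1 : lam θ = 0 := by simpa using h0
    have h2 := lam_sq_add_inv hθ
    rw [h1] at h2
    have h3 : 0 < 4 / Real.tan θ ^ 2 := by have := tan_pos_of_mem hθ; positivity
    norm_num at h2
    linarith
  rw [← h, quartic]
  linear_combination x ^ 4 * mul_inv_cancel₀ h0

theorem hasDerivAt_even_quartic (A B C s : ℂ) :
    HasDerivAt (fun s : ℂ => A * s ^ 4 + B * s ^ 2 + C) (4 * A * s ^ 3 + 2 * B * s) s := by
  have h := (((hasDerivAt_pow 4 s).const_mul A).add ((hasDerivAt_pow 2 s).const_mul B)).add_const C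
  exact h.congr_deriv (by push_cast; ring)

theorem deriv_quartic_snd {θ : ℝ} (hθ : θ ∈ Ioo 0 (Real.pi / 2)) (x y : ℂ) :
    deriv (fun s : ℂ => quartic θ x s) y =
      4 * y ^ 3 + 2 * ((2 + 4 / (Real.tan θ : ℂ) ^ 2) * x ^ 2) * y := by
  have h := hasDerivAt_even_quartic 1 ((2 + 4 / (Real.tan θ : ℂ) ^ 2) * x ^ 2) (x ^ 4) y
  simp only [quartic_eq hθ]
  simpa only [one_mul, mul_one] using h.deriv

theorem deriv_quartic_fst {θ : ℝ} (hθ : θ ∈ Ioo 0 (Real.pi / 2)) (x y : ℂ) :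
    deriv (fun s : ℂ => quartic θ s y) x =
      4 * x ^ 3 + 2 * ((2 + 4 / (Real.tan θ : ℂ) ^ 2) * y ^ 2) * x := by
  have h := hasDerivAt_even_quartic 1 ((2 + 4 / (Real.tan θ : ℂ) ^ 2) * y ^ 2) (y ^ 4) x
  have hq : (fun s : ℂ => quartic θ s y) =
      fun s : ℂ => 1 * s ^ 4 + (2 + 4 / (Real.tan θ : ℂ) ^ 2) * y ^ 2 * s ^ 2 + y ^ 4 := by
    funext s
    rw [quartic_eq hθ]
    ring
  rw [hq, h.deriv]
  ring

/-! ### The antiholomorphic isomorphism on curves -/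

theorem hasDerivAt_conj {f : ℝ → ℂ} (hf : ContDiff ℝ 1 f) (t : ℝ) :
    HasDerivAt (fun t => conj (f t)) (conj (deriv f t)) t :=
  ((hf.differentiable one_ne_zero) t).hasDerivAt.star

theorem contDiff_conj {f : ℝ → ℂ} (hf : ContDiff ℝ 1 f) : ContDiff ℝ 1 fun t => conj (f t) :=
  Complex.conjCLE.contDiff.comp hf

theorem hasDerivAt_conj_sub {f h : ℝ → ℂ} (hf : ContDiff ℝ 1 f) (hh : ContDiff ℝ 1 h) (t : ℝ) :
    HasDerivAt (fun t => conj (f t) - Complex.I * conj (h t))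
      (conj (deriv f t) - Complex.I * conj (deriv h t)) t :=
  (hasDerivAt_conj hf t).sub ((hasDerivAt_conj hh t).const_mul _)

theorem tan_compl (θ : ℝ) : (Real.tan (Real.pi / 2 - θ) : ℂ) = (Real.tan θ : ℂ)⁻¹ := by
  rw [Real.tan_pi_div_two_sub, Complex.ofReal_inv]

/-- The image of a curve under the antiholomorphic isomorphism `Σ_θ → Σ_{π/2-θ}` that covers
`z ↦ (z̄ - i) / (1 - i z̄)`. -/
noncomputable def Curve.conjDual {θ : ℝ} (hθ : θ ∈ Ioo 0 (Real.pi / 2)) (γ : Curve θ) :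
    Curve (Real.pi / 2 - θ) where
  x t := conj (γ.x t) - Complex.I * conj (γ.y t)
  y t := conj (γ.y t) - Complex.I * conj (γ.x t)
  w t := 2 * Complex.I * Real.tan θ * conj (γ.w t)
  vel t := (Real.tan θ : ℂ)⁻¹ * conj (Complex.I * γ.vel t)
  contDiff_x := (contDiff_conj γ.contDiff_x).sub (contDiff_const.mul (contDiff_conj γ.contDiff_y))
  contDiff_y := (contDiff_conj γ.contDiff_y).sub (contDiff_const.mul (contDiff_conj γ.contDiff_x))
  contDiff_w := contDiff_const.mul (contDiff_conj γ.contDiff_w)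
  ne_zero t ht h := by
    rw [Prod.mk.injEq] at h
    refine γ.ne_zero t ht (Prod.ext ?_ ?_)
    · have : conj (γ.x t) = 0 := by
        linear_combination (1 / 2 : ℂ) * h.1 + Complex.I / 2 * h.2 +
          conj (γ.x t) / 2 * Complex.I_sq
      simpa using this
    · have : conj (γ.y t) = 0 := by
        linear_combination (1 / 2 : ℂ) * h.2 + Complex.I / 2 * h.1 +
          conj (γ.y t) / 2 * Complex.I_sq
      simpa using this
  equation t ht := by
    have hk : (Real.tan θ : ℂ) ≠ 0 := by exact_mod_cast (tan_pos_of_mem hθ).ne'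
    have h := congrArg conj (γ.equation t ht)
    rw [quartic_eq hθ] at h
    rw [quartic_eq (pi_div_two_sub_mem hθ), tan_compl]
    simp only [map_add, map_mul, map_pow, map_div₀, map_ofNat, Complex.conj_ofReal] at h
    have hI : Complex.I ^ 2 = -1 := Complex.I_sq
    have hI4 : Complex.I ^ 4 = 1 := Complex.I_pow_four
    rw [mul_pow, h]
    field_simp
    ring_nf
    simp only [hI, hI4, Complex.I_pow_three]
    ring
  vel_z t ht := by
    have hk : (Real.tan θ : ℂ) ≠ 0 := by exact_mod_cast (tan_pos_of_mem hθ).ne'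
    have h := congrArg conj (γ.vel_z t ht)
    rw [(hasDerivAt_conj_sub γ.contDiff_x γ.contDiff_y t).deriv,
      (hasDerivAt_conj_sub γ.contDiff_y γ.contDiff_x t).deriv]
    simp only [map_sub, map_mul, Complex.conj_I] at h ⊢
    field_simp
    linear_combination 2 * h + (conj (γ.y t) * conj (deriv γ.x t) -
      conj (γ.x t) * conj (deriv γ.y t) + 2 * conj (γ.vel t) * conj (γ.w t)) * Complex.I_sq
  vel_x t ht := by
    have hk : (Real.tan θ : ℂ) ≠ 0 := by exact_mod_cast (tan_pos_of_mem hθ).ne'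
    have hx := congrArg conj (γ.vel_x t ht)
    have hy := congrArg conj (γ.vel_y t ht)
    rw [deriv_quartic_snd hθ] at hx
    rw [deriv_quartic_fst hθ] at hy
    rw [(hasDerivAt_conj_sub γ.contDiff_x γ.contDiff_y t).deriv,
      ((hasDerivAt_conj γ.contDiff_w t).const_mul _).deriv,
      deriv_quartic_snd (pi_div_two_sub_mem hθ), tan_compl]
    simp only [map_add, map_sub, map_neg, map_mul, map_pow, map_div₀, map_ofNat,
      Complex.conj_ofReal, Complex.conj_I] at hx hy ⊢
    have hI : Complex.I ^ 2 = -1 := Complex.I_sq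
    -- The substitution mixes `x` and `y`, so the new equation combines the conjugates of both
    -- `vel_x` and `vel_y`.
    trans 2 * Complex.I * Real.tan θ *
      ((conj (γ.x t) * conj (deriv γ.w t) - 2 * conj (γ.w t) * conj (deriv γ.x t)) -
      Complex.I * (conj (γ.y t) * conj (deriv γ.w t) - 2 * conj (γ.w t) * conj (deriv γ.y t)))
    · ring
    rw [hx, hy]
    field_simp
    ring_nf
    simp only [hI, Complex.I_pow_three]
    ring
  vel_y t ht := by
    have hk : (Real.tan θ : ℂ) ≠ 0 := by exact_mod_cast (tan_pos_of_mem hθ).ne'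
    have hx := congrArg conj (γ.vel_x t ht)
    have hy := congrArg conj (γ.vel_y t ht)
    rw [deriv_quartic_snd hθ] at hx
    rw [deriv_quartic_fst hθ] at hy
    rw [(hasDerivAt_conj_sub γ.contDiff_y γ.contDiff_x t).deriv,
      ((hasDerivAt_conj γ.contDiff_w t).const_mul _).deriv,
      deriv_quartic_fst (pi_div_two_sub_mem hθ), tan_compl]
    simp only [map_add, map_sub, map_neg, map_mul, map_pow, map_div₀, map_ofNat,
      Complex.conj_ofReal, Complex.conj_I] at hx hy ⊢
    have hI : Complex.I ^ 2 = -1 := Complex.I_sq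
    trans 2 * Complex.I * Real.tan θ *
      ((conj (γ.y t) * conj (deriv γ.w t) - 2 * conj (γ.w t) * conj (deriv γ.y t)) -
      Complex.I * (conj (γ.x t) * conj (deriv γ.w t) - 2 * conj (γ.w t) * conj (deriv γ.x t)))
    · ring
    rw [hx, hy]
    field_simp
    ring_nf
    simp only [hI, Complex.I_pow_three]
    ring

theorem Curve.IsClosed.conjDual {θ : ℝ} (hθ : θ ∈ Ioo 0 (Real.pi / 2)) {γ : Curve θ}
    (h : γ.IsClosed) : (γ.conjDual hθ).IsClosed := by
  obtain ⟨c, hc, hx, hy, hw⟩ := h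
  refine ⟨conj c, by simpa using hc, ?_, ?_, ?_⟩ <;>
    simp only [Curve.conjDual, hx, hy, hw, map_mul, map_pow] <;> ring

/-- The subtraction formula for `cot (π/4 - θ/2)`, cleared of its denominator; it makes `i λ(θ)` go
to `i λ(π/2 - θ)`. -/
theorem lam_compl {θ : ℝ} (hθ : θ ∈ Ioo 0 (Real.pi / 2)) :
    lam (Real.pi / 2 - θ) * (lam θ - 1) = lam θ + 1 := by
  have h1 : 0 < Real.sin (θ / 2) := Real.sin_pos_of_pos_of_lt_pi (by linarith [hθ.1])
    (by linarith [hθ.2, Real.pi_pos])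
  have h2 : 0 < Real.sin (Real.pi / 4 - θ / 2) :=
    Real.sin_pos_of_pos_of_lt_pi (by linarith [hθ.2]) (by linarith [hθ.1, Real.pi_pos])
  have h3 : (Real.pi / 2 - θ) / 2 = Real.pi / 4 - θ / 2 := by ring
  rw [lam, lam, h3, Real.cot_eq_cos_div_sin, Real.cot_eq_cos_div_sin, div_mul_eq_mul_div,
    div_eq_iff h2.ne', Real.cos_sub, Real.sin_sub, Real.cos_pi_div_four, Real.sin_pi_div_four]
  field_simp

theorem Curve.StartsAtBase.conjDual {θ : ℝ} (hθ : θ ∈ Ioo 0 (Real.pi / 2)) {γ : Curve θ}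
    (h : γ.StartsAtBase) : (γ.conjDual hθ).StartsAtBase := by
  have h1 : (lam (Real.pi / 2 - θ) : ℂ) * (lam θ - 1) = lam θ + 1 := by
    exact_mod_cast congrArg (fun r : ℝ => (r : ℂ)) (lam_compl hθ)
  unfold Curve.StartsAtBase at h ⊢
  simp only [Curve.conjDual, h, map_mul, Complex.conj_I, Complex.conj_ofReal]
  linear_combination Complex.I * conj (γ.x 0) * h1 -
    Complex.I * lam (Real.pi / 2 - θ) * lam θ * conj (γ.x 0) * Complex.I_sq

/-! ### The Gauss map under the isomorphism -/

/-- Replacing `β` by `π/2 - β` swaps the two half-angles up to shifts by `π/4`. The denominator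
acquires the same constant, which cancels in `g`. -/
theorem gaussNum_compl (α β : ℝ) (x y : ℂ) :
    gaussNum α (Real.pi / 2 - β) (conj x - Complex.I * conj y) (conj y - Complex.I * conj x) =
      Real.sqrt 2 * Complex.I * conj (gaussNum α β x y) := by
  have h1 : (α - (Real.pi / 2 - β)) / 2 = (α + β) / 2 - Real.pi / 4 := by ring
  have h2 : (α + (Real.pi / 2 - β)) / 2 = (α - β) / 2 + Real.pi / 4 := by ring
  simp only [gaussNum, h1, h2, Real.cos_sub (_ / 2), Real.sin_sub (_ / 2), Real.cos_add (_ / 2),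
    Real.sin_add (_ / 2), Real.cos_pi_div_four, Real.sin_pi_div_four]
  generalize Real.cos ((α - β) / 2) = a, Real.sin ((α - β) / 2) = b,
    Real.cos ((α + β) / 2) = c, Real.sin ((α + β) / 2) = d
  push_cast
  simp only [map_add, map_mul, Complex.conj_I, Complex.conj_ofReal]
  ring_nf
  simp only [Complex.I_sq]
  ring

theorem gaussDen_compl (α β : ℝ) (x y : ℂ) :
    gaussDen α (Real.pi / 2 - β) (conj x - Complex.I * conj y) (conj y - Complex.I * conj x) =
      Real.sqrt 2 * Complex.I * conj (gaussDen α β x y) := by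
  have h1 : (α - (Real.pi / 2 - β)) / 2 = (α + β) / 2 - Real.pi / 4 := by ring
  have h2 : (α + (Real.pi / 2 - β)) / 2 = (α - β) / 2 + Real.pi / 4 := by ring
  simp only [gaussDen, h1, h2, Real.cos_sub (_ / 2), Real.sin_sub (_ / 2), Real.cos_add (_ / 2),
    Real.sin_add (_ / 2), Real.cos_pi_div_four, Real.sin_pi_div_four]
  generalize Real.cos ((α - β) / 2) = a, Real.sin ((α - β) / 2) = b,
    Real.cos ((α + β) / 2) = c, Real.sin ((α + β) / 2) = d
  push_cast
  simp only [map_add, map_sub, map_mul, Complex.conj_I, Complex.conj_ofReal]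
  ring_nf
  simp only [Complex.I_sq]
  ring

theorem gauss_compl (α β : ℝ) (x y : ℂ) :
    gauss α (Real.pi / 2 - β) (conj x - Complex.I * conj y) (conj y - Complex.I * conj x) =
      conj (gauss α β x y) := by
  have h : (Real.sqrt 2 : ℂ) * Complex.I ≠ 0 := by simp
  rw [gauss, gaussNum_compl, gaussDen_compl, mul_div_mul_left _ _ h, gauss, map_div₀]

theorem Curve.AvoidsEnds.conjDual {θ : ℝ} (hθ : θ ∈ Ioo 0 (Real.pi / 2)) {γ : Curve θ} {α β : ℝ}
    (h : γ.AvoidsEnds α β) : (γ.conjDual hθ).AvoidsEnds α (Real.pi / 2 - β) := by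
  have h0 : (Real.sqrt 2 : ℂ) * Complex.I ≠ 0 := by simp
  intro t ht
  simp only [Curve.conjDual, gaussNum_compl, gaussDen_compl]
  exact ⟨mul_ne_zero h0 ((map_ne_zero _).2 (h t ht).1),
    mul_ne_zero h0 ((map_ne_zero _).2 (h t ht).2)⟩

/-! ### The constant `μ` and the homothety ratio -/

theorem ellipticK_pos {m : ℝ} (h0 : 0 ≤ m) (h1 : m < 1) : 0 < ellipticK m := by
  have h (u : ℝ) : 0 < 1 - m * Real.sin u ^ 2 := by
    nlinarith [mul_le_mul_of_nonneg_left (Real.sin_sq_le_one u) h0]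
  refine intervalIntegral.intervalIntegral_pos_of_pos ?_ (fun u => ?_) (by positivity)
  · refine Continuous.intervalIntegrable ?_ _ _
    exact continuous_const.div (by fun_prop) fun u => (Real.sqrt_pos.2 (h u)).ne'
  · exact one_div_pos.2 (Real.sqrt_pos.2 (h u))

/-- Positivity is all that the argument needs to know about `μ`. -/
theorem mu_pos {θ : ℝ} (hθ : θ ∈ Ioo 0 (Real.pi / 2)) : 0 < mu θ := by
  have h1 : 0 < Real.sin θ := Real.sin_pos_of_pos_of_lt_pi hθ.1 (by linarith [hθ.2, Real.pi_pos])
  have h2 : 0 < Real.cos θ := Real.cos_pos_of_mem_Ioo ⟨by linarith [hθ.1, Real.pi_pos], hθ.2⟩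
  have h3 : Real.sin θ ^ 2 < 1 := by nlinarith [Real.sin_sq_add_cos_sq θ]
  exact div_pos Real.pi_pos (mul_pos h1 (ellipticK_pos (sq_nonneg _) h3))

/-- The ratio of the homothety between `M*_{θ,α,β}` and `M_{π/2-θ,α,π/2-β}`. -/
noncomputable def dualRatio (θ : ℝ) : ℝ := mu (Real.pi / 2 - θ) / (mu θ * Real.tan θ)

theorem dualRatio_pos {θ : ℝ} (hθ : θ ∈ Ioo 0 (Real.pi / 2)) : 0 < dualRatio θ :=
  div_pos (mu_pos (pi_div_two_sub_mem hθ)) (mul_pos (mu_pos hθ) (tan_pos_of_mem hθ))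

theorem dualRatio_mul_compl {θ : ℝ} (hθ : θ ∈ Ioo 0 (Real.pi / 2)) :
    dualRatio θ * dualRatio (Real.pi / 2 - θ) = 1 := by
  have h1 := mu_pos hθ
  have h2 := mu_pos (pi_div_two_sub_mem hθ)
  have h3 := tan_pos_of_mem hθ
  rw [dualRatio, dualRatio, sub_sub_cancel, Real.tan_pi_div_two_sub]
  generalize mu (Real.pi / 2 - θ) = m at *
  field_simp

/-! ### Transformation of the Weierstrass integrals -/

/-- The homothety of ratio `r` followed by the reflection in the plane `x₂ = 0`. -/
def scaledReflection (r : ℝ) : EuclideanSpace ℝ (Fin 3) →+ EuclideanSpace ℝ (Fin 3) where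
  toFun X := reflectX2 0 (r • X)
  map_zero' := by ext j; fin_cases j <;> simp [reflectX2]
  map_add' X Y := by
    ext j
    fin_cases j <;> simp [reflectX2]
    all_goals ring

theorem scaledReflection_apply (r : ℝ) (X : EuclideanSpace ℝ (Fin 3)) :
    scaledReflection r X = reflectX2 0 (r • X) := rfl

theorem scaledReflection_scaledReflection {r s : ℝ} (h : r * s = 1)
    (X : EuclideanSpace ℝ (Fin 3)) : scaledReflection r (scaledReflection s X) = X := by
  ext j
  fin_cases j <;> simp [scaledReflection_apply, reflectX2, ← mul_assoc, h]

/-- Only the middle coefficient carries a factor `i`; this sign is the source of the reflection. -/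
theorem weierstrassCoeff_conj (g : ℂ) (j : Fin 3) :
    weierstrassCoeff (conj g) j = ![1, -1, 1] j * conj (weierstrassCoeff g j) := by
  have h : conj (2 : ℂ) = 2 := map_ofNat _ 2
  fin_cases j <;> simp [weierstrassCoeff, h]
  ring

/-- `κ = 1` takes the conjugate surface to the standard one, and `κ = i` gives the way back, as `i ·
conj i = 1`. -/
theorem displacement_conjDual {θ : ℝ} (hθ : θ ∈ Ioo 0 (Real.pi / 2)) (κ : ℂ) (α β : ℝ)
    (γ : Curve θ) :
    displacement κ α (Real.pi / 2 - β) (γ.conjDual hθ) =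
      scaledReflection (dualRatio θ) (displacement (Complex.I * conj κ) α β γ) := by
  have hk := (tan_pos_of_mem hθ).ne'
  have hm := (mu_pos hθ).ne'
  have key (j : Fin 3) : (displacement κ α (Real.pi / 2 - β) (γ.conjDual hθ)) j =
      ![1, -1, 1] j * (dualRatio θ * displacement (Complex.I * conj κ) α β γ j) := by
    have hint : ∫ t in (0 : ℝ)..1, weierstrassCoeff (gauss α (Real.pi / 2 - β)
        ((γ.conjDual hθ).x t) ((γ.conjDual hθ).y t)) j *
          ((mu (Real.pi / 2 - θ) : ℂ) * (γ.conjDual hθ).vel t) =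
        ((![1, -1, 1] j * dualRatio θ : ℝ) : ℂ) * (conj Complex.I *
          conj (∫ t in (0 : ℝ)..1, weierstrassCoeff (gauss α β (γ.x t) (γ.y t)) j *
            ((mu θ : ℂ) * γ.vel t))) := by
      rw [← intervalIntegral.intervalIntegral_conj, ← intervalIntegral.integral_const_mul,
        ← intervalIntegral.integral_const_mul]
      congr 1
      funext t
      have h1 : ((![1, -1, 1] j : ℝ) : ℂ) = ![1, -1, 1] j := by fin_cases j <;> simp
      simp only [Curve.conjDual, gauss_compl, weierstrassCoeff_conj, map_mul, Complex.conj_ofReal,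
        dualRatio]
      push_cast [h1]
      have hk' : (Complex.tan θ) ≠ 0 := by exact_mod_cast hk
      have hm' : (mu θ : ℂ) ≠ 0 := by exact_mod_cast hm
      field_simp
    simp only [displacement]
    rw [hint, mul_left_comm, Complex.re_ofReal_mul, mul_assoc, ← Complex.conj_re (_ * _)]
    simp only [map_mul, Complex.conj_conj]
    congr 3
    ring
  ext j
  fin_cases j <;> simp [key, scaledReflection_apply, reflectX2]

/-! ### Duality of the surfaces -/

theorem coincideUpToReflection_dual {θ α β : ℝ} (hθ : θ ∈ Ioo 0 (Real.pi / 2)) :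
    CoincideUpToReflection (dualRatio θ) (conjugateExample θ α β)
      (standardExample (Real.pi / 2 - θ) α (Real.pi / 2 - β)) := by
  have hθ' := pi_div_two_sub_mem hθ
  have fwd (γ : Curve θ) : displacement 1 α (Real.pi / 2 - β) (γ.conjDual hθ) =
      scaledReflection (dualRatio θ) (displacement Complex.I α β γ) := by
    simpa using displacement_conjDual hθ 1 α β γ
  have bwd (γ : Curve (Real.pi / 2 - θ)) : scaledReflection (dualRatio θ)
      (displacement Complex.I α (Real.pi / 2 - (Real.pi / 2 - β)) (γ.conjDual hθ')) =
        displacement 1 α (Real.pi / 2 - β) γ := by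
    rw [displacement_conjDual hθ' Complex.I,
      scaledReflection_scaledReflection (dualRatio_mul_compl hθ)]
    simp
  -- `P` stands for `StartsAtBase` (lifts) or `IsClosed` (period generators).
  have image_eq (P : ∀ {θ : ℝ}, Curve θ → Prop)
      (hP : ∀ {θ : ℝ} (hθ : θ ∈ Ioo 0 (Real.pi / 2)) (γ : Curve θ), P γ → P (γ.conjDual hθ)) :
      {X | ∃ γ : Curve (Real.pi / 2 - θ), γ.AvoidsEnds α (Real.pi / 2 - β) ∧ P γ ∧
          X = displacement 1 α (Real.pi / 2 - β) γ} =
        scaledReflection (dualRatio θ) '' {X | ∃ γ : Curve θ, γ.AvoidsEnds α β ∧ P γ ∧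
          X = displacement Complex.I α β γ} := by
    ext X
    constructor
    · rintro ⟨γ, hγ, hPγ, rfl⟩
      -- The double dual lives over `π/2 - (π/2 - θ)`, which is only propositionally `θ`, so the
      -- curve type needs transport.
      have key : ∀ φ β', φ = θ → β' = β → ∀ δ : Curve φ, δ.AvoidsEnds α β' → P δ →
          displacement Complex.I α β' δ ∈ {X | ∃ γ : Curve θ, γ.AvoidsEnds α β ∧ P γ ∧
            X = displacement Complex.I α β γ} := by
        rintro _ _ rfl rfl δ hδ hPδ
        exact ⟨δ, hδ, hPδ, rfl⟩
      exact ⟨_, key _ _ (sub_sub_cancel _ _) (sub_sub_cancel _ _) (γ.conjDual hθ')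
        (hγ.conjDual hθ') (hP hθ' γ hPγ), bwd γ⟩
    · rintro ⟨_, ⟨γ, hγ, hPγ, rfl⟩, rfl⟩
      exact ⟨γ.conjDual hθ, hγ.conjDual hθ, hP hθ γ hPγ, (fwd γ).symm⟩
  -- Base points correspond, so no translation is needed and `b = 0`.
  refine ⟨0, image_eq Curve.StartsAtBase fun hθ γ h => h.conjDual hθ, ?_⟩
  have h := congrArg AddSubgroup.closure
    (image_eq Curve.IsClosed fun hθ γ h => h.conjDual hθ)
  rw [← AddMonoidHom.map_closure] at h
  exact congrArg (fun H : AddSubgroup _ => (H : Set (EuclideanSpace ℝ (Fin 3)))) h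

theorem dual_mem_paramRange {θ α β : ℝ} (h : (θ, α, β) ∈ paramRange) :
    (Real.pi / 2 - θ, α, Real.pi / 2 - β) ∈ paramRange := by
  obtain ⟨h1, h2, h3, h4⟩ := h
  refine ⟨pi_div_two_sub_mem h1, h2, ⟨by linarith [h3.2], by linarith [h3.1]⟩, fun h => h4 ?_⟩
  simp only [Prod.mk.injEq] at h ⊢
  exact ⟨h.1, by linarith [h.2]⟩

end StandardExamples

theorem mainTheorem8 :
    (∀ θ α β : ℝ, (θ, α, β) ∈ paramRange →
      (Real.pi / 2 - θ, α, Real.pi / 2 - β) ∈ paramRange ∧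
      0 < mu (Real.pi / 2 - θ) / (mu θ * Real.tan θ) ∧
      CoincideUpToReflection (mu (Real.pi / 2 - θ) / (mu θ * Real.tan θ))
        (conjugateExample θ α β)
        (standardExample (Real.pi / 2 - θ) α (Real.pi / 2 - β))) ∧
    (∀ θ α β : ℝ, (θ, α, β) ∈ paramRange →
      ∃ θ' α' β' : ℝ, (θ', α', β') ∈ paramRange ∧
        ∃ r : ℝ, 0 < r ∧
          CoincideUpToReflection r (conjugateExample θ α β) (standardExample θ' α' β')) ∧
    (∀ θ' α' β' : ℝ, (θ', α', β') ∈ paramRange →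
      ∃ θ α β : ℝ, (θ, α, β) ∈ paramRange ∧
        ∃ r : ℝ, 0 < r ∧
          CoincideUpToReflection r (conjugateExample θ α β) (standardExample θ' α' β')) := by
  have dual (θ α β : ℝ) (h : (θ, α, β) ∈ paramRange) :
      CoincideUpToReflection (dualRatio θ) (conjugateExample θ α β)
        (standardExample (Real.pi / 2 - θ) α (Real.pi / 2 - β)) := coincideUpToReflection_dual h.1
  refine ⟨fun θ α β h => ⟨dual_mem_paramRange h, dualRatio_pos h.1, dual θ α β h⟩,
    fun θ α β h => ⟨_, _, _, dual_mem_paramRange h, _, dualRatio_pos h.1, dual θ α β h⟩,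
    fun θ α β h => ⟨_, _, _, dual_mem_paramRange h, _, dualRatio_pos (dual_mem_paramRange h).1, ?_⟩⟩
  -- The parameter map is an involution, so the dual triple serves as the preimage.
  simpa only [sub_sub_cancel] using dual _ _ _ (dual_mem_paramRange h)
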